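/- Let $q$ be an odd prime power, and let $t, m$ be positive integers with $2t\le m$. Let $\mathbb{S}(2t,m)$ be the set of symmetric $m\times m$ matrices over $\mathbb{F}_q$ of rank at most $2t$, and let $n=|\mathbb{S}(2t,m)|$. The affine symmetric determinantal code $\widehat{C}_{symm}(2t,m)\subseteq\mathbb{F}_q^{n}$ is the linear code consisting of all words $\hat{c}_f=(f(A))_{A\in\mathbb{S}(2t,m)}$, where $f$ runs over the homogeneous linear polynomials over $\mathbb{F}_q$ in the $m^2$ variables $X_{ij}$, $1\le i,j\le m$. For $\delta\in\mathbb{F}_q^*$ let $W_1^{\delta}(2t,m)$ be the Hamming weight of the codeword of $f_1^\delta=\delta X_{11}$, that is, the number of $A\in\mathbb{S}(2t,m)$ with $\delta A_{11}\ne 0$. Then, for every $\delta\in\mathbb{F}_q^*$, the minimum distance of $\widehat{C}_{symm}(2t,m)$ is $W_1^{\delta}(2t,m)$. -/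

import Mathlib

open MvPolynomial

/-- The set `𝕊(t, m)` of symmetric `m × m` matrices over `F` of rank at most `t`. -/
def SymmDet (F : Type*) [Field F] (t m : ℕ) : Set (Matrix (Fin m) (Fin m) F) :=
  {A | A.IsSymm ∧ A.rank ≤ t}

noncomputable instance SymmDet.instFintype (F : Type*) [Field F] [Fintype F] (t m : ℕ) :
    Fintype (SymmDet F t m) :=
  Fintype.ofFinite _

/-- Evaluation of polynomials in the `m ^ 2` variables `X (i, j)` at all the points of `𝕊(t, m)`.
Words are indexed by `𝕊(t, m)` itself, so their length is the cardinality of `𝕊(t, m)`. -/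
noncomputable def symmEv (F : Type*) [Field F] (t m : ℕ) :
    MvPolynomial (Fin m × Fin m) F →ₗ[F] (SymmDet F t m → F) :=
  LinearMap.pi fun A => (aeval fun ij : Fin m × Fin m => A.1 ij.1 ij.2).toLinearMap

/-- The affine symmetric determinantal code: the image under evaluation of the space of
homogeneous linear polynomials. -/
noncomputable def affineSymmCode (F : Type*) [Field F] (t m : ℕ) :
    Submodule F (SymmDet F t m → F) :=
  (homogeneousSubmodule (Fin m × Fin m) F 1).map (symmEv F t m)

/-- `d` is the minimum distance of the linear code `C`: the least Hamming distance
between two distinct codewords. -/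
def IsMinDist {ι F : Type*} [Fintype ι] [Field F] [DecidableEq F]
    (C : Submodule F (ι → F)) (d : ℕ) : Prop :=
  IsLeast {n | ∃ x ∈ C, ∃ y ∈ C, x ≠ y ∧ n = hammingDist x y} d

/-- The polynomial `X₁₁ + ⋯ + X_{k-1,k-1} + δ X_{kk}` (zero for `k = 0`); the variable `X_{ii}`
is `X (j, j)` with `j = i - 1 : Fin m`, as `Fin m` starts at zero. -/
noncomputable def diagForm {F : Type*} [Field F] (m k : ℕ) (δ : F) :
    MvPolynomial (Fin m × Fin m) F :=
  ∑ j : Fin m, C (if j.1 + 1 < k then 1 else if j.1 + 1 = k then δ else 0) * X (j, j)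

/-- The number `W_k^δ(t, m)`: the Hamming weight of the codeword of `diagForm m k δ`, that is, the
number of `A ∈ 𝕊(t, m)` at which this polynomial does not vanish. -/
noncomputable def symmWeight {F : Type*} [Field F] [Fintype F] [DecidableEq F]
    (k : ℕ) (δ : F) (t m : ℕ) : ℕ :=
  hammingNorm (symmEv F t m (diagForm m k δ))

/-!
Let `ψ` be a nontrivial additive character of `F`. By orthogonality of characters, the weight of the
word `A ↦ tr (S A)` is smaller the larger the sums
`E (u S) = ∑ ψ (tr (u S A))` are, where `A` runs over the symmetric matrices of rank at most `2t`
and `u` over the nonzero scalars (`hammingNorm_le_of_re_sum_le`). As `q` is odd, every codeword is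
of this form with `S` symmetric, so it is enough that among nonzero symmetric `S` the real part of
`E S` is largest in rank one (`re_sum_lowRank_le`). Since `E` is invariant under congruence, `S` may
be taken diagonal, `S = diag (s, d)` with `s ≠ 0`.

Write a symmetric matrix as `C` bordered by a vector `b` and a corner `a`. Given a weight `φ`
invariant under congruence, consider the sum of `φ (A) ψ (tr (S A))` over all symmetric `A`. For `b`
outside the range of `C` a shear moves the corner freely, so that the sum over `a` vanishes; for
`b = C z`, completing the square turns the sum over `z` into the Gauss sum `g (s C)` of the quadratic
form `s C`. The result is a sum of the same kind over the symmetric matrices `C`, at the frequency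
`d`, for another weight (`diagFourier_sumElim`). For `φ` the indicator of rank at most `2t`, the new
weight is `g (s C)` on the matrices `C` of rank exactly `2t`, up to a positive constant
(`peel_lowRank`). It remains to see that the transform of this Gauss weight is largest at `d = 0`.

If `d ≠ 0`, the same step applies with a nonzero entry `s'` of `d`. Now the new weight is
nonnegative (`peel_gaussWeight_nonneg`): scaling a form of rank `ρ` by `s` multiplies its Gauss sum
by `η (s) ^ ρ`, with `η` the quadratic character, so that on the ranks `2t` and `2t - 1` that occur
all signs cancel and the square of the Gauss sum of a form of even rank remains, which is a squared
absolute value. Hence the transform does not decrease if the entries of `d` other than `s'` are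
replaced by zero. Finally `s'` may be replaced by zero as well, without any change
(`diagFourier_gaussWeight_corner`): the Gauss weights of the matrices of rank `2t` with a given
nonzero corner `a` add up to zero, because these are congruent to `a ⊕ C` with `C` of odd rank
`2t - 1`, and the Gauss sum of `C` changes sign under scaling `C` by a nonsquare.
-/

open Matrix

/-! ### Symmetric matrices and congruence -/

/-- The type of symmetric matrices with rows and columns indexed by `ι`. -/
abbrev SymMat (ι F : Type*) := {A : Matrix ι ι F // A.IsSymm}

noncomputable instance SymMat.instFintype {ι F : Type*} [Finite ι] [Finite F] :
    Fintype (SymMat ι F) :=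
  Fintype.ofFinite _

/-- Invariance of a function of matrices under congruence `A ↦ Pᵀ A P`. -/
def CongrInvariant {ι F : Type*} [Fintype ι] [DecidableEq ι] [CommRing F]
    (φ : Matrix ι ι F → ℂ) : Prop :=
  ∀ P A : Matrix ι ι F, IsUnit P.det → φ (Pᵀ * A * P) = φ A

section Congruence

variable {F : Type*} [Field F] {ι : Type*} [Fintype ι] [DecidableEq ι]

theorem rank_congr (P A : Matrix ι ι F) (hP : IsUnit P.det) : (Pᵀ * A * P).rank = A.rank := by
  rw [rank_mul_eq_left_of_isUnit_det _ _ hP,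
    rank_mul_eq_right_of_isUnit_det _ _ (by rwa [det_transpose])]

theorem sum_symMat_congr [Fintype F] (P : Matrix ι ι F) (hP : IsUnit P.det)
    (f : Matrix ι ι F → ℂ) :
    ∑ A : SymMat ι F, f (Pᵀ * A.1 * P) = ∑ A : SymMat ι F, f A.1 := by
  refine Fintype.sum_bijective
    (fun A : SymMat ι F => (⟨Pᵀ * A.1 * P, by
      have := A.2.eq
      simp [IsSymm, Matrix.transpose_mul, this, Matrix.mul_assoc]⟩ : SymMat ι F))
    (Finite.injective_iff_bijective.mp ?_) _ _ fun _ => rfl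
  intro A B h
  have h' : Pᵀ * A.1 * P = Pᵀ * B.1 * P := congrArg Subtype.val h
  have hPu : IsUnit P := (isUnit_iff_isUnit_det P).2 hP
  have hPt : IsUnit Pᵀ := (isUnit_iff_isUnit_det _).2 (by rwa [det_transpose])
  exact Subtype.ext (hPt.mul_left_cancel (hPu.mul_right_cancel h'))

/-- In characteristic other than two every symmetric matrix is congruent to a diagonal one. -/
theorem exists_eq_transpose_mul_diagonal_mul (h2 : (2 : F) ≠ 0) {S : Matrix ι ι F}
    (hS : S.IsSymm) :
    ∃ (Q : Matrix ι ι F) (d : ι → F), IsUnit Q.det ∧ S = Qᵀ * diagonal d * Q := by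
  let _ : Invertible (2 : F) := invertibleOfNonzero h2
  have hB : (Matrix.toBilin' S).IsSymm := isSymm_toBilin'_iff_isSymm.2 hS
  obtain ⟨v, hv⟩ := LinearMap.BilinForm.exists_orthogonal_basis
    (LinearMap.BilinForm.isSymm_iff.1 hB)
  let e : Fin (Module.finrank F (ι → F)) ≃ ι :=
    (finCongr (by simp)).trans (Fintype.equivFin ι).symm
  let b := v.reindex e
  refine ⟨b.toMatrix (Pi.basisFun F ι), fun i => Matrix.toBilin' S (b i) (b i), ?_, ?_⟩
  · exact isUnit_det_of_left_inverse (B := (Pi.basisFun F ι).toMatrix b) (by simp)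
  · have hd : LinearMap.BilinForm.toMatrix b (Matrix.toBilin' S)
        = diagonal fun i => Matrix.toBilin' S (b i) (b i) := by
      ext i j
      rw [LinearMap.BilinForm.toMatrix_apply]
      by_cases hij : i = j
      · subst hij; simp
      · rw [diagonal_apply_ne _ hij]
        have := hv (i := e.symm i) (j := e.symm j) (by simpa using hij)
        simpa [b] using this
    rw [← hd, LinearMap.BilinForm.toMatrix_mul_basis_toMatrix,
      LinearMap.BilinForm.toMatrix_basisFun, LinearMap.BilinForm.toMatrix'_toBilin']

end Congruence

/-! ### Gauss sums of quadratic forms -/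

section Gauss

variable {F : Type*} [Field F] [Fintype F] {ι : Type*} [Fintype ι] [DecidableEq ι]

/-- The Gauss sum `∑ ψ(xᵀ A x)` of the quadratic form of `A`. -/
noncomputable def formGauss (ψ : AddChar F ℂ) (A : Matrix ι ι F) : ℂ :=
  ∑ x : ι → F, ψ (x ⬝ᵥ A *ᵥ x)

omit [Fintype F] in
theorem addChar_map_sum {κ : Type*} (ψ : AddChar F ℂ) (s : Finset κ) (f : κ → F) :
    ψ (∑ i ∈ s, f i) = ∏ i ∈ s, ψ (f i) := by
  classical
  induction s using Finset.induction_on with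
  | empty => simp
  | insert a s ha ih => rw [Finset.sum_insert ha, Finset.prod_insert ha, ψ.map_add_eq_mul, ih]

/-- The Gauss sum of the one-dimensional quadratic form `a y²`. -/
noncomputable def sqGauss (ψ : AddChar F ℂ) (a : F) : ℂ :=
  ∑ y : F, ψ (a * y ^ 2)

omit [Fintype F] [DecidableEq ι] in
theorem dotProduct_congr_mulVec (P A : Matrix ι ι F) (x : ι → F) :
    x ⬝ᵥ (Pᵀ * A * P) *ᵥ x = (P *ᵥ x) ⬝ᵥ A *ᵥ (P *ᵥ x) := by
  rw [← Matrix.mulVec_mulVec, ← Matrix.mulVec_mulVec, dotProduct_mulVec, vecMul_transpose]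

theorem formGauss_congr (ψ : AddChar F ℂ) (P A : Matrix ι ι F) (hP : IsUnit P.det) :
    formGauss ψ (Pᵀ * A * P) = formGauss ψ A := by
  refine Fintype.sum_bijective (fun x => P *ᵥ x)
    (Finite.injective_iff_bijective.mp ?_) _ _ fun x => by rw [dotProduct_congr_mulVec]
  exact Matrix.mulVec_injective_iff_isUnit.2 ((isUnit_iff_isUnit_det P).2 hP)

theorem formGauss_diagonal (ψ : AddChar F ℂ) (d : ι → F) :
    formGauss ψ (diagonal d) = ∏ i, sqGauss ψ (d i) := by
  unfold formGauss sqGauss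
  rw [Finset.prod_univ_sum, Fintype.piFinset_univ]
  refine Finset.sum_congr rfl fun x _ => ?_
  rw [← addChar_map_sum]
  congr 1
  simp only [dotProduct, mulVec_diagonal]
  exact Finset.sum_congr rfl fun i _ => by ring

theorem sqGauss_zero (ψ : AddChar F ℂ) : sqGauss ψ 0 = Fintype.card F := by
  simp [sqGauss]

/-- Counting square roots with the quadratic character: the quadratic Gauss sum as a character
sum. -/
theorem sqGauss_eq_gaussSum [DecidableEq F] (h2 : ringChar F ≠ 2) {ψ : AddChar F ℂ}
    (hψ : ψ.IsPrimitive) {a : F} (ha : a ≠ 0) :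
    sqGauss ψ a = ∑ b : F, ((quadraticChar F b : ℤ) : ℂ) * ψ (a * b) := by
  have h1 : sqGauss ψ a
      = ∑ b : F, ∑ y : F, if y ^ 2 = b then ψ (a * b) else 0 := by
    rw [Finset.sum_comm]
    simp [sqGauss]
  have h0 : ∑ b : F, ψ (a * b) = 0 := by
    have := AddChar.sum_mulShift a hψ
    simpa [mul_comm, ha] using this
  have h3 : ∀ b : F, (∑ y : F, if y ^ 2 = b then ψ (a * b) else 0)
      = ((quadraticChar F b : ℤ) : ℂ) * ψ (a * b) + ψ (a * b) := by
    intro b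
    have := quadraticChar_card_sqrts h2 b
    have h4 : (((Finset.univ.filter fun y : F => y ^ 2 = b).card : ℤ) : ℂ)
        = ((quadraticChar F b : ℤ) : ℂ) + 1 := by
      rw [← Int.cast_one, ← Int.cast_add, ← this]
      congr 3
      ext y; simp
    rw [← Finset.sum_filter, Finset.sum_const, nsmul_eq_mul]
    push_cast at h4
    rw [h4]; ring
  rw [h1, Finset.sum_congr rfl fun b _ => h3 b, Finset.sum_add_distrib, h0, add_zero]

theorem sqGauss_mul [DecidableEq F] (h2 : ringChar F ≠ 2) {ψ : AddChar F ℂ}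
    (hψ : ψ.IsPrimitive) {s a : F} (hs : s ≠ 0) (ha : a ≠ 0) :
    sqGauss ψ (s * a) = ((quadraticChar F s : ℤ) : ℂ) * sqGauss ψ a := by
  rw [sqGauss_eq_gaussSum h2 hψ (mul_ne_zero hs ha), sqGauss_eq_gaussSum h2 hψ ha,
    Finset.mul_sum]
  refine Fintype.sum_equiv (Equiv.mulLeft₀ s hs) _ _ fun b => ?_
  have h : ((quadraticChar F s : ℤ) : ℂ) * ((quadraticChar F s : ℤ) : ℂ) = 1 := by
    rw [← Int.cast_mul, ← sq, quadraticChar_sq_one hs, Int.cast_one]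
  change _ = _ * (((quadraticChar F (s * b) : ℤ) : ℂ) * ψ (a * (s * b)))
  simp only [map_mul, Int.cast_mul]
  rw [← mul_assoc, ← mul_assoc, h, one_mul]
  congr 2
  ring

/-- Scaling a quadratic form of rank `ρ` by `s ≠ 0` multiplies its Gauss sum by `η(s) ^ ρ`, where
`η` is the quadratic character. -/
theorem formGauss_smul [DecidableEq F] (h2 : ringChar F ≠ 2) {ψ : AddChar F ℂ}
    (hψ : ψ.IsPrimitive) {s : F} (hs : s ≠ 0) {A : Matrix ι ι F} (hA : A.IsSymm) :
    formGauss ψ (s • A) = ((quadraticChar F s : ℤ) : ℂ) ^ A.rank * formGauss ψ A := by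
  obtain ⟨Q, d, hQ, rfl⟩ :=
    exists_eq_transpose_mul_diagonal_mul (Ring.two_ne_zero h2) hA
  have : s • (Qᵀ * diagonal d * Q) = Qᵀ * diagonal (s • d) * Q := by
    rw [diagonal_smul]; simp
  rw [this, rank_congr _ _ hQ, formGauss_congr _ _ _ hQ, formGauss_congr _ _ _ hQ,
    formGauss_diagonal, formGauss_diagonal, rank_diagonal, Fintype.card_subtype,
    ← Finset.prod_const, Finset.prod_filter, ← Finset.prod_mul_distrib]
  refine Finset.prod_congr rfl fun i _ => ?_
  by_cases hi : d i = 0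
  · simp [hi]
  · simp [hi, sqGauss_mul h2 hψ hs hi]

theorem formGauss_neg (ψ : AddChar F ℂ) (A : Matrix ι ι F) :
    formGauss ψ (-A) = (starRingEnd ℂ) (formGauss ψ A) := by
  simp [formGauss, map_sum, Matrix.neg_mulVec, AddChar.map_neg_eq_conj]

theorem sqGauss_neg (ψ : AddChar F ℂ) (a : F) :
    sqGauss ψ (-a) = (starRingEnd ℂ) (sqGauss ψ a) := by
  simp [sqGauss, map_sum, AddChar.map_neg_eq_conj]

end Gauss

/-! ### Bordered matrices -/

section Border

variable {F : Type*} [Field F] {ι : Type*} [Fintype ι] [DecidableEq ι]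

/-- The symmetric bordering of `C` by the corner `a` and the vector `b`. -/
def border (a : F) (b : ι → F) (C : Matrix ι ι F) : Matrix (Unit ⊕ ι) (Unit ⊕ ι) F :=
  fromBlocks (of fun _ _ => a) (replicateRow Unit b) (replicateCol Unit b) C

omit [Field F] [Fintype ι] [DecidableEq ι] in
theorem isSymm_border (a : F) (b : ι → F) {C : Matrix ι ι F} (hC : C.IsSymm) :
    (border a b C).IsSymm := by
  ext i j
  rcases i with i | i <;> rcases j with j | j <;> simp [border, hC.apply]

omit [Field F] in
/-- Summation over symmetric matrices of size one larger, by corner, border and remaining block. -/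
theorem sum_symMat_border [Fintype F] (f : Matrix (Unit ⊕ ι) (Unit ⊕ ι) F → ℂ) :
    ∑ B : SymMat (Unit ⊕ ι) F, f B.1
      = ∑ C : SymMat ι F, ∑ b : ι → F, ∑ a : F, f (border a b C.1) := by
  let e : SymMat ι F × (ι → F) × F ≃ SymMat (Unit ⊕ ι) F :=
    { toFun := fun p => ⟨border p.2.2 p.2.1 p.1.1, isSymm_border _ _ p.1.2⟩
      invFun := fun B => (⟨B.1.toBlocks₂₂, by
          ext i j
          exact B.2.apply _ _⟩, fun i => B.1 (Sum.inl ()) (Sum.inr i), B.1 (Sum.inl ()) (Sum.inl ()))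
      left_inv := by
        rintro ⟨⟨C, hC⟩, b, a⟩
        simp [border]
      right_inv := by
        rintro ⟨B, hB⟩
        refine Subtype.ext ?_
        ext i j
        rcases i with i | i <;> rcases j with j | j <;> simp [border, hB.apply, toBlocks₂₂] }
  rw [← Fintype.sum_equiv e (fun p => f (border p.2.2 p.2.1 p.1.1)) _ fun _ => rfl,
    Fintype.sum_prod_type]
  simp_rw [Fintype.sum_prod_type]

/-- The unipotent matrix adding multiples of the border to the remaining indices. -/
def shearRow (z : ι → F) : Matrix (Unit ⊕ ι) (Unit ⊕ ι) F :=
  fromBlocks 1 (replicateRow Unit z) 0 1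

/-- The unipotent matrix adding a combination of the remaining indices to the border. -/
def shearCol (z : ι → F) : Matrix (Unit ⊕ ι) (Unit ⊕ ι) F :=
  fromBlocks 1 0 (replicateCol Unit z) 1

theorem isUnit_det_shearRow (z : ι → F) : IsUnit (shearRow z).det := by
  simp [shearRow]

theorem isUnit_det_shearCol (z : ι → F) : IsUnit (shearCol z).det := by
  simp [shearCol]

theorem shearCol_congr_border (a : F) (b z : ι → F) {C : Matrix ι ι F} (hC : C.IsSymm) :
    (shearCol z)ᵀ * border a b C * shearCol z
      = border (a + 2 * (b ⬝ᵥ z) + z ⬝ᵥ C *ᵥ z) (b + C *ᵥ z) C := by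
  have h : ∀ i, (replicateRow Unit z * C) () i = (C *ᵥ z) i := fun i => by
    simp only [mul_apply, replicateRow_apply, mulVec, dotProduct]
    exact Finset.sum_congr rfl fun j _ => by rw [hC.apply, mul_comm]
  ext i j
  rcases i with i | i <;> rcases j with j | j <;>
    simp only [shearCol, border, fromBlocks_transpose, fromBlocks_multiply, transpose_one,
      transpose_zero, transpose_replicateCol, Matrix.one_mul, Matrix.mul_one, Matrix.zero_mul,
      Matrix.mul_zero, zero_add, fromBlocks_apply₁₁, fromBlocks_apply₁₂,
      fromBlocks_apply₂₁, fromBlocks_apply₂₂, Matrix.add_apply, of_apply, replicateRow_apply,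
      replicateCol_apply, Pi.add_apply]
  · rw [Matrix.add_mul, Matrix.add_apply, Matrix.mul_apply (M := replicateRow Unit z * C)]
    simp only [h, replicateRow_mul_replicateCol_apply, replicateCol_apply]
    simp only [dotProduct, Finset.sum_congr rfl fun i _ => mul_comm (z i) (b i),
      Finset.sum_congr rfl fun i _ => mul_comm (z i) ((C *ᵥ z) i)]
    ring
  · rw [h]
  · rfl

/-- A nonzero corner clears the border: `a ⊕ C` is congruent to the matrix with border `a z` and
remaining block `C + a z zᵀ`. -/
theorem shearRow_congr_border (a : F) (z : ι → F) (C : Matrix ι ι F) :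
    (shearRow z)ᵀ * border a 0 C * shearRow z = border a (a • z) (C + a • vecMulVec z z) := by
  ext i j
  rcases i with i | i <;> rcases j with j | j <;>
    simp [shearRow, border, fromBlocks_transpose, fromBlocks_multiply]
  · simp [mul_apply]
  · simp [mul_apply, mul_comm]
  · rw [add_comm]
    simp [mul_apply, vecMulVec_apply]
    ring

end Border

section BorderInvariants

variable {F : Type*} [Field F] [Fintype F] {ι : Type*} [Fintype ι] [DecidableEq ι]

theorem formGauss_border_zero (ψ : AddChar F ℂ) (a : F) (C : Matrix ι ι F) :
    formGauss ψ (border a 0 C) = sqGauss ψ a * formGauss ψ C := by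
  unfold formGauss sqGauss
  rw [← (Equiv.sumArrowEquivProdArrow Unit ι F).symm.sum_comp, Fintype.sum_prod_type,
    ← (Equiv.funUnique Unit F).symm.sum_comp, Finset.sum_mul_sum]
  refine Finset.sum_congr rfl fun y _ => Finset.sum_congr rfl fun x _ => ?_
  rw [← AddChar.map_add_eq_mul]
  congr 1
  simp [border, dotProduct, mulVec, Fintype.sum_sum_type]
  ring

omit [Fintype F] in
theorem rank_border_zero [DecidableEq F] (h2 : (2 : F) ≠ 0) (a : F) {C : Matrix ι ι F}
    (hC : C.IsSymm) :
    (border a 0 C).rank = C.rank + if a = 0 then 0 else 1 := by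
  obtain ⟨Q, d, hQ, rfl⟩ := exists_eq_transpose_mul_diagonal_mul h2 hC
  have h : border a 0 (Qᵀ * diagonal d * Q)
      = (fromBlocks (1 : Matrix Unit Unit F) 0 0 Q)ᵀ * diagonal (Sum.elim (fun _ => a) d)
        * fromBlocks 1 0 0 Q := by
    rw [← fromBlocks_diagonal]
    ext i j
    rcases i with i | i <;> rcases j with j | j <;>
      simp [-fromBlocks_diagonal, fromBlocks_transpose, fromBlocks_multiply, border]
  rw [h, rank_congr _ _ hQ, rank_congr _ _ (by simpa using hQ), rank_diagonal, rank_diagonal,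
    Fintype.card_subtype, Fintype.card_subtype, Finset.card_filter, Finset.card_filter,
    Fintype.sum_sum_type, add_comm]
  congr 1
  by_cases ha : a = 0 <;> simp [ha]

/-- The number of solutions of a homogeneous linear system. -/
theorem card_filter_mulVec_eq_zero [DecidableEq F] (C : Matrix ι ι F) :
    (Finset.univ.filter fun x : ι → F => C *ᵥ x = 0).card
      = Fintype.card F ^ (Fintype.card ι - C.rank) := by
  have h := LinearMap.finrank_range_add_finrank_ker C.mulVecLin
  rw [Module.finrank_fintype_fun_eq_card] at h
  have h' : Fintype.card ι - C.rank = Module.finrank F (LinearMap.ker C.mulVecLin) := by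
    rw [Matrix.rank]; omega
  rw [h', ← Nat.card_eq_fintype_card, ← Module.natCard_eq_pow_finrank]
  exact (Nat.subtype_card _ fun x => by simp).symm

/-- Summing over the range of a matrix, with multiplicity. -/
theorem sum_comp_mulVec [DecidableEq F] (C : Matrix ι ι F) (H : (ι → F) → ℂ)
    (hH : ∀ b, (∀ z, C *ᵥ z ≠ b) → H b = 0) :
    ∑ z, H (C *ᵥ z) = (Fintype.card F : ℂ) ^ (Fintype.card ι - C.rank) * ∑ b, H b := by
  rw [← Finset.sum_fiberwise' Finset.univ (fun z => C *ᵥ z) H, Finset.mul_sum]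
  refine Finset.sum_congr rfl fun b _ => ?_
  rw [Finset.sum_const, nsmul_eq_mul]
  by_cases hb : ∃ z, C *ᵥ z = b
  · congr 1
    have h : (Finset.univ.filter fun z : ι → F => C *ᵥ z = b).card
        = (Finset.univ.filter fun z : ι → F => C *ᵥ z = 0).card := by
      convert AddMonoidHom.card_fiber_eq_of_mem_range C.mulVecLin (x := b) (y := 0)
        (by simpa using hb) ⟨0, by simp⟩ <;> rfl
    rw [← Nat.cast_pow, ← card_filter_mulVec_eq_zero, ← h]
  · rw [hH b (by simpa using hb)]; simp

omit [Fintype F] in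
/-- A vector outside the range of a symmetric matrix is not orthogonal to its kernel. -/
theorem exists_ker_dotProduct_ne_zero {C : Matrix ι ι F} (hC : C.IsSymm) {b : ι → F}
    (hb : ∀ z, C *ᵥ z ≠ b) : ∃ w, C *ᵥ w = 0 ∧ b ⬝ᵥ w ≠ 0 := by
  obtain ⟨f, hf, hf0⟩ := Submodule.exists_dual_map_eq_bot_of_notMem
    (p := LinearMap.range C.mulVecLin) (x := b) (by simpa using hb) inferInstance
  have hfx : ∀ x, f x = x ⬝ᵥ fun i => f (Pi.single i 1) := fun x => by
    conv_lhs => rw [LinearMap.pi_apply_eq_sum_univ f x]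
    refine Finset.sum_congr rfl fun i _ => ?_
    rw [smul_eq_mul]
    congr 2
    ext j
    simp [Pi.single_apply, eq_comm]
  refine ⟨fun i => f (Pi.single i 1), ?_, by rwa [← hfx]⟩
  refine dotProduct_eq_zero _ fun x => ?_
  have : f (C *ᵥ x) = 0 := by
    have : f (C *ᵥ x) ∈ (LinearMap.range C.mulVecLin).map f :=
      ⟨_, ⟨x, rfl⟩, rfl⟩
    simpa [hf0] using this
  rw [← this, hfx, dotProduct_comm, dotProduct_mulVec, ← mulVec_transpose, hC.eq]

end BorderInvariants

/-! ### Character sums over symmetric matrices -/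

section CharSum

variable {F : Type*} [Field F] [Fintype F] {ι : Type*} [Fintype ι] [DecidableEq ι]

/-- The Fourier transform of `φ` over the symmetric matrices, at the diagonal matrix `d`. -/
noncomputable def diagFourier (ψ : AddChar F ℂ) (φ : Matrix ι ι F → ℂ) (d : ι → F) : ℂ :=
  ∑ A : SymMat ι F, φ A.1 * ψ (∑ i, d i * A.1 i i)

/-- The weight on symmetric matrices of size `ι` obtained from a weight `φ` on matrices of size one
larger by summing out the corner and the border against the frequency `s` of the corner. -/
noncomputable def peel (ψ : AddChar F ℂ) (s : F) (φ : Matrix (Unit ⊕ ι) (Unit ⊕ ι) F → ℂ)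
    (C : Matrix ι ι F) : ℂ :=
  ((Fintype.card F : ℂ) ^ (Fintype.card ι - C.rank))⁻¹ * formGauss ψ (s • C)
    * ∑ a, φ (border a 0 C) * ψ (s * a)

omit [Fintype F] in
/-- A congruence-invariant weight at `border a b C` does not depend on the corner `a` when `b` is
outside the range of `C`. -/
theorem CongrInvariant.border_eq (h2 : (2 : F) ≠ 0)
    {φ : Matrix (Unit ⊕ ι) (Unit ⊕ ι) F → ℂ}
    (hφ : CongrInvariant φ) {C : Matrix ι ι F} (hC : C.IsSymm) {b : ι → F}
    (hb : ∀ z, C *ᵥ z ≠ b) (a a' : F) : φ (border a b C) = φ (border a' b C) := by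
  obtain ⟨w, hw, hbw⟩ := exists_ker_dotProduct_ne_zero hC hb
  rw [← hφ (shearCol (((a' - a) / (2 * (b ⬝ᵥ w))) • w)) _ (isUnit_det_shearCol _),
    shearCol_congr_border _ _ _ hC]
  congr 2
  · simp only [mulVec_smul, hw, smul_zero, dotProduct_zero, dotProduct_smul, smul_eq_mul, add_zero]
    field_simp
    ring
  · simp [mulVec_smul, hw]

omit [Fintype F] in
/-- When `b = C z`, completing the square clears the border. -/
theorem CongrInvariant.border_mulVec {φ : Matrix (Unit ⊕ ι) (Unit ⊕ ι) F → ℂ}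
    (hφ : CongrInvariant φ) {C : Matrix ι ι F} (hC : C.IsSymm) (z : ι → F) (a : F) :
    φ (border (a + z ⬝ᵥ C *ᵥ z) (C *ᵥ z) C) = φ (border a 0 C) := by
  rw [← hφ (shearCol z) (border a 0 C) (isUnit_det_shearCol _), shearCol_congr_border _ _ _ hC]
  simp

/-- If the corner has a nonzero frequency, then the corner and the border can be summed out. -/
theorem diagFourier_sumElim [DecidableEq F] (h2 : (2 : F) ≠ 0) {ψ : AddChar F ℂ}
    (hψ : ψ.IsPrimitive) {φ : Matrix (Unit ⊕ ι) (Unit ⊕ ι) F → ℂ} (hφ : CongrInvariant φ)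
    {s : F} (hs : s ≠ 0) (d : ι → F) :
    diagFourier ψ φ (Sum.elim (fun _ => s) d) = diagFourier ψ (peel ψ s φ) d := by
  unfold diagFourier
  rw [sum_symMat_border fun B => φ B * ψ (∑ i, Sum.elim (fun _ => s) d i * B i i)]
  refine Finset.sum_congr rfl fun C _ => ?_
  obtain ⟨C, hC⟩ := C
  set H : (ι → F) → ℂ := fun b => ∑ a, φ (border a b C) * ψ (s * a) with hH
  have h1 : ∀ b a, φ (border a b C)
      * ψ (∑ i, Sum.elim (fun _ => s) d i * border a b C i i)
      = φ (border a b C) * ψ (s * a) * ψ (∑ i, d i * C i i) := fun b a => by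
    rw [mul_assoc, ← AddChar.map_add_eq_mul]
    simp [border]
  -- Off the range of `C` the weight is constant in `a`, and a nontrivial character sums to zero.
  have h0 : ∀ b, (∀ z, C *ᵥ z ≠ b) → H b = 0 := fun b hb => by
    have hz := AddChar.sum_mulShift s hψ
    simp only [hs, if_false, Nat.cast_zero] at hz
    simp only [hH, hφ.border_eq h2 hC hb _ 0, ← Finset.mul_sum]
    simp [mul_comm s, hz]
  have h3 : ∀ z, H (C *ᵥ z)
      = ψ (z ⬝ᵥ (s • C) *ᵥ z) * ∑ a, φ (border a 0 C) * ψ (s * a) := fun z => by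
    simp only [hH]
    rw [← Equiv.sum_comp (Equiv.addRight (z ⬝ᵥ C *ᵥ z)), Finset.mul_sum]
    refine Finset.sum_congr rfl fun a _ => ?_
    simp only [Equiv.coe_addRight, hφ.border_mulVec hC, mul_add, AddChar.map_add_eq_mul,
      smul_mulVec, dotProduct_smul, smul_eq_mul]
    ring
  have hq : (Fintype.card F : ℂ) ^ (Fintype.card ι - C.rank) ≠ 0 :=
    pow_ne_zero _ (Nat.cast_ne_zero.2 Fintype.card_ne_zero)
  have h4 := sum_comp_mulVec C H h0
  simp only [h3, ← Finset.sum_mul] at h4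
  simp only [h1, ← Finset.sum_mul]
  change (∑ b, H b) * _ = _
  congr 1
  rw [peel, mul_assoc, eq_inv_mul_iff_mul_eq₀ hq, ← h4]
  rfl

end CharSum

section Weights

variable {F : Type*} [Field F] [Fintype F] {ι : Type*} [Fintype ι] [DecidableEq ι]

/-- The indicator function of the matrices of rank at most `r`. -/
noncomputable def lowRank (r : ℕ) (A : Matrix ι ι F) : ℂ :=
  if A.rank ≤ r then 1 else 0

/-- The normalised Gauss sum of `s • A`, on the matrices `A` of rank exactly `r`. -/
noncomputable def gaussWeight (ψ : AddChar F ℂ) (s : F) (r : ℕ) (A : Matrix ι ι F) : ℂ :=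
  if A.rank = r then
    ((Fintype.card F : ℂ) ^ (Fintype.card ι - A.rank))⁻¹ * formGauss ψ (s • A)
  else 0

omit [Fintype F] in
theorem congrInvariant_lowRank (r : ℕ) : CongrInvariant (lowRank r : Matrix ι ι F → ℂ) :=
  fun P A hP => by simp [lowRank, rank_congr P A hP]

theorem congrInvariant_gaussWeight (ψ : AddChar F ℂ) (s : F) (r : ℕ) :
    CongrInvariant (gaussWeight ψ s r : Matrix ι ι F → ℂ) := fun P A hP => by
  have h : s • (Pᵀ * A * P) = Pᵀ * (s • A) * P := by simp
  simp only [gaussWeight, rank_congr P A hP, h, formGauss_congr ψ P _ hP]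

/-- Peeling the indicator of rank at most `r`: a block of rank less than `r` leaves the corner
free, and a block of rank `r` determines it. -/
theorem peel_lowRank [DecidableEq F] (h2 : (2 : F) ≠ 0) {ψ : AddChar F ℂ}
    (hψ : ψ.IsPrimitive) {s : F} (hs : s ≠ 0) (r : ℕ) {C : Matrix ι ι F} (hC : C.IsSymm) :
    peel ψ s (lowRank r) C = gaussWeight ψ s r C := by
  have hz := AddChar.sum_mulShift s hψ
  simp only [hs, if_false, Nat.cast_zero, mul_comm _ s] at hz
  simp only [peel, lowRank, gaussWeight, rank_border_zero h2 _ hC]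
  rcases lt_trichotomy C.rank r with h | h | h
  · have h' : ∀ a : F, C.rank + (if a = 0 then 0 else 1) ≤ r := fun a => by split_ifs <;> omega
    simp [h', hz, h.ne]
  · have h' : ∀ a : F, C.rank + (if a = 0 then 0 else 1) ≤ r ↔ a = 0 := fun a => by
      split_ifs with ha <;> simp [ha, h]
    simp only [h', if_pos h]
    simp
  · have h' : ∀ a : F, ¬ C.rank + (if a = 0 then 0 else 1) ≤ r := fun a => by omega
    simp only [h', if_false, zero_mul, Finset.sum_const_zero, mul_zero, h.ne']

theorem formGauss_smul_of_even [DecidableEq F] (h2 : ringChar F ≠ 2) {ψ : AddChar F ℂ}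
    (hψ : ψ.IsPrimitive) {s : F} (hs : s ≠ 0) {A : Matrix ι ι F} (hA : A.IsSymm)
    (hr : Even A.rank) : formGauss ψ (s • A) = formGauss ψ A := by
  obtain ⟨k, hk⟩ := hr
  rw [formGauss_smul h2 hψ hs hA, hk, ← two_mul, pow_mul, ← Int.cast_pow,
    quadraticChar_sq_one hs]
  simp

theorem formGauss_smul_of_odd [DecidableEq F] (h2 : ringChar F ≠ 2) {ψ : AddChar F ℂ}
    (hψ : ψ.IsPrimitive) {s : F} (hs : s ≠ 0) {A : Matrix ι ι F} (hA : A.IsSymm)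
    (hr : Odd A.rank) :
    formGauss ψ (s • A) = ((quadraticChar F s : ℤ) : ℂ) * formGauss ψ A := by
  obtain ⟨k, hk⟩ := hr
  rw [formGauss_smul h2 hψ hs hA, hk, pow_succ, pow_mul, ← Int.cast_pow,
    quadraticChar_sq_one hs]
  simp

/-- The Gauss sum of a form of even rank is real. -/
theorem formGauss_sq_of_even [DecidableEq F] (h2 : ringChar F ≠ 2) {ψ : AddChar F ℂ}
    (hψ : ψ.IsPrimitive) {A : Matrix ι ι F} (hA : A.IsSymm) (hr : Even A.rank) :
    formGauss ψ A ^ 2 = (Complex.normSq (formGauss ψ A) : ℂ) := by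
  have h := formGauss_neg ψ A
  rw [← neg_one_smul F A, formGauss_smul_of_even h2 hψ (neg_ne_zero.2 one_ne_zero) hA hr] at h
  rw [← Complex.mul_conj, ← h, sq]

omit [Fintype F] [Fintype ι] [DecidableEq ι] in
theorem smul_border (s a : F) (b : ι → F) (C : Matrix ι ι F) :
    s • border a b C = border (s * a) (s • b) (s • C) := by
  ext i j
  rcases i with i | i <;> rcases j with j | j <;> simp [border]

theorem gaussWeight_border [DecidableEq F] (h2 : (2 : F) ≠ 0) (ψ : AddChar F ℂ) (s a : F) (r : ℕ)
    {C : Matrix ι ι F} (hC : C.IsSymm) :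
    gaussWeight ψ s r (border a 0 C) = if C.rank + (if a = 0 then 0 else 1) = r then
      ((Fintype.card F : ℂ) ^ (Fintype.card ι + 1 - r))⁻¹
        * (sqGauss ψ (s * a) * formGauss ψ (s • C)) else 0 := by
  unfold gaussWeight
  rw [rank_border_zero h2 a hC]
  by_cases h : C.rank + (if a = 0 then 0 else 1) = r
  · rw [if_pos h, if_pos h, h, smul_border, smul_zero, formGauss_border_zero, Fintype.card_sum,
      Fintype.card_unit, add_comm 1]
  · rw [if_neg h, if_neg h]

/-- Peeling the Gauss weight at an even rank leaves a nonnegative weight. -/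
theorem peel_gaussWeight_nonneg [DecidableEq F] (h2 : ringChar F ≠ 2) {ψ : AddChar F ℂ}
    (hψ : ψ.IsPrimitive) {s s' : F} (hs : s ≠ 0) (hs' : s' ≠ 0) {r : ℕ} (hr : Even r)
    {C : Matrix ι ι F} (hC : C.IsSymm) :
    ∃ x : ℝ, 0 ≤ x ∧ peel ψ s' (gaussWeight ψ s r) C = x := by
  have h2' := Ring.two_ne_zero h2
  unfold peel
  simp only [gaussWeight_border h2' ψ s _ r hC]
  by_cases h : C.rank = r
  · have h' : ∀ a : F, C.rank + (if a = 0 then 0 else 1) = r ↔ a = 0 := fun a => by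
      split_ifs with ha <;> simp [ha, h]
    have he : Even C.rank := h ▸ hr
    -- Only `a = 0` contributes, and the Gauss sums of `s • C` and `s' • C` agree.
    refine ⟨((Fintype.card F : ℝ) ^ (Fintype.card ι - C.rank))⁻¹
      * (((Fintype.card F : ℝ) ^ (Fintype.card ι + 1 - r))⁻¹
      * (Fintype.card F * Complex.normSq (formGauss ψ C))),
      by have := Complex.normSq_nonneg (formGauss ψ C); positivity, ?_⟩
    push_cast
    rw [← formGauss_sq_of_even h2 hψ hC he, formGauss_smul_of_even h2 hψ hs hC he,
      formGauss_smul_of_even h2 hψ hs' hC he]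
    simp [h', sqGauss_zero]
    ring
  by_cases h1 : C.rank + 1 = r
  · have h' : ∀ a : F, C.rank + (if a = 0 then 0 else 1) = r ↔ a ≠ 0 := fun a => by
      split_ifs with ha
      · simp [ha, h]
      · simp [ha, h1]
    have ho : Odd C.rank := by
      rw [← h1, Nat.even_add_one, Nat.not_even_iff_odd] at hr
      exact hr
    -- The rank of `C` is odd; the even-rank form whose Gauss sum gets squared is `1 ⊕ C`.
    have hB : (border 1 0 C).IsSymm := isSymm_border _ _ hC
    have hBr : Even (border 1 0 C).rank := by
      rw [rank_border_zero h2' _ hC]; simpa [h1] using hr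
    have hη : ∀ {u : F}, u ≠ 0 →
        ((quadraticChar F u : ℤ) : ℂ) * ((quadraticChar F u : ℤ) : ℂ) = 1 := fun hu => by
      rw [← Int.cast_mul, ← sq, quadraticChar_sq_one hu, Int.cast_one]
    have key : ∑ a : F, (if a ≠ 0 then sqGauss ψ (s * a) else 0) * ψ (s' * a)
        = ((quadraticChar F s : ℤ) : ℂ) * ((quadraticChar F s' : ℤ) : ℂ) * sqGauss ψ 1 ^ 2 := by
      have h3 : sqGauss ψ s' = ((quadraticChar F s' : ℤ) : ℂ) * sqGauss ψ 1 := by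
        simpa using sqGauss_mul h2 hψ hs' (one_ne_zero (α := F))
      have h4 : ∀ a : F, (if a ≠ 0 then sqGauss ψ (s * a) else 0) * ψ (s' * a)
          = ((quadraticChar F s : ℤ) : ℂ) * sqGauss ψ 1
            * (((quadraticChar F a : ℤ) : ℂ) * ψ (s' * a)) := fun a => by
        by_cases ha : a = 0
        · simp [ha]
        · have h5 := sqGauss_mul h2 hψ (mul_ne_zero hs ha) (one_ne_zero (α := F))
          rw [mul_one, map_mul, Int.cast_mul] at h5
          rw [if_pos ha, h5]
          ring
      rw [Finset.sum_congr rfl fun a _ => h4 a, ← Finset.mul_sum,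
        ← sqGauss_eq_gaussSum h2 hψ hs', h3]
      ring
    refine ⟨((Fintype.card F : ℝ) ^ (Fintype.card ι - C.rank))⁻¹
      * (((Fintype.card F : ℝ) ^ (Fintype.card ι + 1 - r))⁻¹
      * Complex.normSq (formGauss ψ (border 1 0 C))),
      by have := Complex.normSq_nonneg (formGauss ψ (border 1 0 C)); positivity, ?_⟩
    push_cast
    rw [← formGauss_sq_of_even h2 hψ hB hBr, formGauss_border_zero,
      formGauss_smul_of_odd h2 hψ hs hC ho, formGauss_smul_of_odd h2 hψ hs' hC ho]
    have h6 : ∀ a : F, (if C.rank + (if a = 0 then 0 else 1) = r then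
        ((Fintype.card F : ℂ) ^ (Fintype.card ι + 1 - r))⁻¹
          * (sqGauss ψ (s * a) * (((quadraticChar F s : ℤ) : ℂ) * formGauss ψ C)) else 0)
          * ψ (s' * a)
        = ((Fintype.card F : ℂ) ^ (Fintype.card ι + 1 - r))⁻¹
          * (((quadraticChar F s : ℤ) : ℂ) * formGauss ψ C)
          * ((if a ≠ 0 then sqGauss ψ (s * a) else 0) * ψ (s' * a)) := fun a => by
      simp only [h']
      split_ifs <;> ring
    rw [Finset.sum_congr rfl fun a _ => h6 a, ← Finset.mul_sum, key]
    linear_combination (((Fintype.card F : ℂ) ^ (Fintype.card ι - C.rank))⁻¹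
      * ((Fintype.card F : ℂ) ^ (Fintype.card ι + 1 - r))⁻¹ * formGauss ψ C ^ 2 * sqGauss ψ 1 ^ 2)
      * (((quadraticChar F s : ℤ) : ℂ) * ((quadraticChar F s : ℤ) : ℂ) * hη hs' + hη hs)
  · have h' : ∀ a : F, ¬ C.rank + (if a = 0 then 0 else 1) = r := fun a => by
      split_ifs <;> omega
    exact ⟨0, le_rfl, by simp [h']⟩

/-- At an even rank, the Gauss weights of the matrices with a given nonzero corner and a given
border cancel: up to congruence they are `a ⊕ C'` with `C'` of odd rank, and scaling `C'` by a
nonsquare changes the sign. -/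
theorem sum_gaussWeight_border_eq_zero [DecidableEq F] (h2 : ringChar F ≠ 2) {ψ : AddChar F ℂ}
    (hψ : ψ.IsPrimitive) {s : F} (hs : s ≠ 0) {r : ℕ} (hr : Even r) {a : F} (ha : a ≠ 0)
    (b : ι → F) : ∑ C : SymMat ι F, gaussWeight ψ s r (border a b C.1) = 0 := by
  have h2' := Ring.two_ne_zero h2
  obtain ⟨z, rfl⟩ : ∃ z, b = a • z := ⟨a⁻¹ • b, by rw [smul_inv_smul₀ ha]⟩
  have hV : (a • vecMulVec z z).IsSymm := by
    ext i j; simp [vecMulVec_apply, mul_comm]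
  let e : SymMat ι F ≃ SymMat ι F :=
    { toFun := fun C => ⟨C.1 + a • vecMulVec z z, C.2.add hV⟩
      invFun := fun C => ⟨C.1 - a • vecMulVec z z, C.2.sub hV⟩
      left_inv := fun C => Subtype.ext (add_sub_cancel_right _ _)
      right_inv := fun C => Subtype.ext (sub_add_cancel _ _) }
  have h1 : ∑ C : SymMat ι F, gaussWeight ψ s r (border a (a • z) C.1)
      = ∑ C : SymMat ι F, gaussWeight ψ s r (border a 0 C.1) := by
    rw [← e.sum_comp]
    refine Finset.sum_congr rfl fun C _ => ?_
    change gaussWeight ψ s r (border a (a • z) (C.1 + a • vecMulVec z z)) = _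
    rw [← shearRow_congr_border, congrInvariant_gaussWeight ψ s r _ _ (isUnit_det_shearRow z)]
  rw [h1]
  obtain ⟨l, hl⟩ := quadraticChar_exists_neg_one h2
  have hl0 : l ≠ 0 := by
    rintro rfl
    simp at hl
  let e' : SymMat ι F ≃ SymMat ι F :=
    { toFun := fun C => ⟨l • C.1, C.2.smul l⟩
      invFun := fun C => ⟨l⁻¹ • C.1, C.2.smul l⁻¹⟩
      left_inv := fun C => Subtype.ext (inv_smul_smul₀ hl0 _)
      right_inv := fun C => Subtype.ext (smul_inv_smul₀ hl0 _) }
  refine self_eq_neg.1 ?_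
  rw [← Finset.sum_neg_distrib, ← e'.sum_comp]
  refine Finset.sum_congr rfl fun C _ => ?_
  change gaussWeight ψ s r (border a 0 (l • C.1)) = _
  rw [gaussWeight_border h2' ψ s a r (C.2.smul l), gaussWeight_border h2' ψ s a r C.2,
    rank_smul_of_mem_nonZeroDivisors _ (mem_nonZeroDivisors_of_ne_zero hl0), if_neg ha]
  by_cases h : C.1.rank + 1 = r
  · have ho : Odd C.1.rank := by
      rw [← h, Nat.even_add_one, Nat.not_even_iff_odd] at hr
      exact hr
    rw [if_pos h, if_pos h, smul_comm, formGauss_smul_of_odd h2 hψ hl0 (C.2.smul s), hl]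
    · push_cast; ring
    · rwa [rank_smul_of_mem_nonZeroDivisors _ (mem_nonZeroDivisors_of_ne_zero hs)]
  · simp [h]

/-- The Fourier transform of the Gauss weight of even rank takes the same value at the zero matrix
and at the matrices supported on the corner: only the matrices with zero corner contribute. -/
theorem diagFourier_gaussWeight_corner [DecidableEq F] (h2 : ringChar F ≠ 2) {ψ : AddChar F ℂ}
    (hψ : ψ.IsPrimitive) {s : F} (hs : s ≠ 0) {r : ℕ} (hr : Even r) (s' : F) :
    diagFourier ψ (gaussWeight ψ s r) (Sum.elim (fun _ : Unit => s') (0 : ι → F))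
      = diagFourier ψ (gaussWeight ψ s r) (0 : Unit ⊕ ι → F) := by
  have h : ∀ s' : F, diagFourier ψ (gaussWeight ψ s r) (Sum.elim (fun _ : Unit => s') (0 : ι → F))
      = ∑ C : SymMat ι F, ∑ b, gaussWeight ψ s r (border 0 b C.1) := fun s' => by
    unfold diagFourier
    rw [sum_symMat_border fun B => gaussWeight ψ s r B
      * ψ (∑ i, Sum.elim (fun _ : Unit => s') (0 : ι → F) i * B i i)]
    rw [Finset.sum_comm, Finset.sum_comm (s := (Finset.univ : Finset (SymMat ι F)))]
    refine Finset.sum_congr rfl fun b _ => ?_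
    rw [Finset.sum_comm, Finset.sum_eq_single 0]
    · simp [border]
    · intro a _ ha
      have h1 : ∀ C : Matrix ι ι F, ∑ i, Sum.elim (fun _ : Unit => s') (0 : ι → F) i
          * border a b C i i = s' * a := fun C => by simp [border]
      simp only [h1, ← Finset.sum_mul, sum_gaussWeight_border_eq_zero h2 hψ hs hr ha b, zero_mul]
    · simp
  have h0 : (0 : Unit ⊕ ι → F) = Sum.elim (fun _ : Unit => (0 : F)) (0 : ι → F) := by
    ext i; rcases i with i | i <;> rfl
  rw [h0, h, h]

end Weights

/-! ### Comparison of the character sums -/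

section Comparison

variable {F : Type*} [Field F] [Fintype F] {ι : Type*} [Fintype ι] [DecidableEq ι]

omit [DecidableEq ι] in
/-- Transporting the Fourier transform along a bijection of index types. -/
theorem diagFourier_reindex {κ : Type*} [Fintype κ] (ψ : AddChar F ℂ) (e : κ ≃ ι)
    {φ : Matrix ι ι F → ℂ} {φ' : Matrix κ κ F → ℂ} (h : ∀ A, φ' (A.submatrix e e) = φ A)
    (d : ι → F) : diagFourier ψ φ' (d ∘ e) = diagFourier ψ φ d := by
  let E : SymMat ι F ≃ SymMat κ F :=
    { toFun := fun A => ⟨A.1.submatrix e e, A.2.submatrix e⟩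
      invFun := fun A => ⟨A.1.submatrix e.symm e.symm, A.2.submatrix e.symm⟩
      left_inv := fun A => Subtype.ext (by simp)
      right_inv := fun A => Subtype.ext (by simp) }
  unfold diagFourier
  rw [← E.sum_comp]
  refine Finset.sum_congr rfl fun A _ => ?_
  change φ' (A.1.submatrix e e) * ψ (∑ i, d (e i) * A.1 (e i) (e i)) = _
  rw [h, e.sum_comp fun i => d i * A.1 i i]

omit [Fintype F] [DecidableEq ι] in
theorem lowRank_submatrix {κ : Type*} [Fintype κ] (e : κ ≃ ι) (r : ℕ)
    (A : Matrix ι ι F) : lowRank r (A.submatrix e e) = lowRank r A := by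
  simp [lowRank, rank_submatrix]

theorem formGauss_submatrix {κ : Type*} [Fintype κ] [DecidableEq κ] (ψ : AddChar F ℂ) (e : κ ≃ ι)
    (A : Matrix ι ι F) : formGauss ψ (A.submatrix e e) = formGauss ψ A := by
  unfold formGauss
  rw [← (e.arrowCongr (Equiv.refl F)).symm.sum_comp]
  refine Finset.sum_congr rfl fun x _ => ?_
  have h : (e.arrowCongr (Equiv.refl F)).symm x = x ∘ e := rfl
  rw [h, submatrix_mulVec_equiv, Function.comp_assoc, Equiv.self_comp_symm, Function.comp_id,
    comp_equiv_dotProduct_comp_equiv]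

theorem gaussWeight_submatrix {κ : Type*} [Fintype κ] [DecidableEq κ] (ψ : AddChar F ℂ) (s : F)
    (e : κ ≃ ι) (r : ℕ) (A : Matrix ι ι F) :
    gaussWeight ψ s r (A.submatrix e e) = gaussWeight ψ s r A := by
  have h : s • A.submatrix e e = (s • A).submatrix e e := rfl
  simp only [gaussWeight, rank_submatrix, h, formGauss_submatrix, Fintype.card_congr e]

omit [Fintype ι] in
/-- Singling out one index of a finite type. -/
theorem exists_equiv_unit_sum (i : ι) :
    ∃ e : Unit ⊕ {j // j ≠ i} ≃ ι, e (Sum.inl ()) = i := by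
  refine ⟨(Equiv.sumComm _ _).trans
    ((Equiv.optionEquivSumPUnit _).symm.trans (Equiv.optionSubtypeNe i)), by simp⟩

omit [DecidableEq ι] in
/-- The Fourier transform of a nonnegative weight is largest at zero. -/
theorem re_diagFourier_le_of_nonneg (ψ : AddChar F ℂ) {φ : Matrix ι ι F → ℂ}
    (hφ : ∀ C : Matrix ι ι F, C.IsSymm → ∃ x : ℝ, 0 ≤ x ∧ φ C = x) (d : ι → F) :
    (diagFourier ψ φ d).re ≤ (diagFourier ψ φ 0).re := by
  unfold diagFourier
  rw [Complex.re_sum, Complex.re_sum]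
  refine Finset.sum_le_sum fun C _ => ?_
  obtain ⟨x, hx, h⟩ := hφ C.1 C.2
  rw [h, Complex.re_ofReal_mul, Complex.re_ofReal_mul]
  refine mul_le_mul_of_nonneg_left ?_ hx
  refine (Complex.re_le_norm _).trans ?_
  simp [AddChar.norm_apply]

/-- The Fourier transform of the Gauss weight of even rank is largest at the zero matrix. -/
theorem re_diagFourier_gaussWeight_le [DecidableEq F] (h2 : ringChar F ≠ 2) {ψ : AddChar F ℂ}
    (hψ : ψ.IsPrimitive) {s : F} (hs : s ≠ 0) {r : ℕ} (hr : Even r) (d : ι → F) :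
    (diagFourier ψ (gaussWeight ψ s r) d).re
      ≤ (diagFourier ψ (gaussWeight ψ s r) (0 : ι → F)).re := by
  by_cases hd : d = 0
  · rw [hd]
  obtain ⟨i, hi⟩ := Function.ne_iff.1 hd
  obtain ⟨e, he⟩ := exists_equiv_unit_sum i
  have hinv := gaussWeight_submatrix (F := F) ψ s e r
  rw [← diagFourier_reindex ψ e hinv, ← diagFourier_reindex ψ e hinv]
  have h1 : d ∘ e = Sum.elim (fun _ => d i) (d ∘ e ∘ Sum.inr) := by
    ext j; rcases j with ⟨⟩ | j <;> simp [he]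
  have h0 : (0 : ι → F) ∘ e = 0 := rfl
  rw [h0, h1, ← diagFourier_gaussWeight_corner h2 hψ hs hr (d i),
    diagFourier_sumElim (Ring.two_ne_zero h2) hψ (congrInvariant_gaussWeight ψ s r) hi,
    diagFourier_sumElim (Ring.two_ne_zero h2) hψ (congrInvariant_gaussWeight ψ s r) hi]
  exact re_diagFourier_le_of_nonneg ψ
    (fun C hC => peel_gaussWeight_nonneg h2 hψ hs hi hr hC) _

omit [DecidableEq ι] in
/-- Scaling permutes the matrices of rank at most `r`. -/
theorem diagFourier_lowRank_smul (ψ : AddChar F ℂ) (r : ℕ) {c : F} (hc : c ≠ 0) (d : ι → F) :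
    diagFourier ψ (lowRank r) (c • d) = diagFourier ψ (lowRank r) d := by
  let e : SymMat ι F ≃ SymMat ι F :=
    { toFun := fun C => ⟨c • C.1, C.2.smul c⟩
      invFun := fun C => ⟨c⁻¹ • C.1, C.2.smul c⁻¹⟩
      left_inv := fun C => Subtype.ext (inv_smul_smul₀ hc _)
      right_inv := fun C => Subtype.ext (smul_inv_smul₀ hc _) }
  unfold diagFourier
  rw [← e.sum_comp fun A => lowRank r A.1 * ψ (∑ i, d i * A.1 i i)]
  refine Finset.sum_congr rfl fun C _ => ?_
  change _ = lowRank r (c • C.1) * ψ (∑ i, d i * (c * C.1 i i))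
  rw [lowRank, lowRank, rank_smul_of_mem_nonZeroDivisors _ (mem_nonZeroDivisors_of_ne_zero hc)]
  congr 2
  exact Finset.sum_congr rfl fun i _ => by simp only [Pi.smul_apply, smul_eq_mul]; ring

/-- Among nonzero diagonal matrices, those of rank one maximise the Fourier transform of the set of
symmetric matrices whose rank is at most a given even number. -/
theorem re_diagFourier_lowRank_le [DecidableEq F] (h2 : ringChar F ≠ 2) {ψ : AddChar F ℂ}
    (hψ : ψ.IsPrimitive) {r : ℕ} (hr : Even r) {d : ι → F} (hd : d ≠ 0) (i₀ : ι) {δ : F}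
    (hδ : δ ≠ 0) :
    (diagFourier ψ (lowRank r) d).re ≤ (diagFourier ψ (lowRank r) (Pi.single i₀ δ)).re := by
  obtain ⟨i, hi⟩ := Function.ne_iff.1 hd
  rw [Pi.zero_apply] at hi
  have h3 : diagFourier ψ (lowRank r) (Pi.single i₀ δ)
      = diagFourier ψ (lowRank r) (Pi.single i (d i)) := by
    rw [← diagFourier_lowRank_smul ψ r (div_ne_zero hδ hi) (Pi.single i (d i)),
      ← diagFourier_reindex ψ (Equiv.swap i i₀) (lowRank_submatrix (Equiv.swap i i₀) r)]
    congr 1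
    ext j
    simp [Pi.single_apply, Equiv.swap_apply_eq_iff, hi]
  obtain ⟨e, he⟩ := exists_equiv_unit_sum i
  have hinv := lowRank_submatrix (F := F) e r
  have h1 : d ∘ e = Sum.elim (fun _ => d i) (d ∘ e ∘ Sum.inr) := by
    ext j; rcases j with ⟨⟩ | j <;> simp [he]
  have h0 : (Pi.single i (d i) : ι → F) ∘ e = Sum.elim (fun _ => d i) 0 := by
    ext j
    rcases j with ⟨⟩ | j
    · simp [he]
    · have : e (Sum.inr j) ≠ i := fun h => by
        simpa using e.injective (h.trans he.symm)
      simp [this]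
  have h4 : ∀ d' : {j // j ≠ i} → F, diagFourier ψ (peel ψ (d i) (lowRank r)) d'
      = diagFourier ψ (gaussWeight ψ (d i) r) d' := fun d' => by
    unfold diagFourier
    exact Finset.sum_congr rfl fun C _ => by
      rw [peel_lowRank (Ring.two_ne_zero h2) hψ hi r C.2]
  rw [h3, ← diagFourier_reindex ψ e hinv, ← diagFourier_reindex ψ e hinv, h0, h1,
    diagFourier_sumElim (Ring.two_ne_zero h2) hψ (congrInvariant_lowRank r) hi,
    diagFourier_sumElim (Ring.two_ne_zero h2) hψ (congrInvariant_lowRank r) hi, h4, h4]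
  exact re_diagFourier_gaussWeight_le h2 hψ hi hr _

/-- Among nonzero symmetric matrices, those of rank one maximise the Fourier transform of the set
of symmetric matrices whose rank is at most a given even number. -/
theorem re_sum_lowRank_le [DecidableEq F] (h2 : ringChar F ≠ 2) {ψ : AddChar F ℂ}
    (hψ : ψ.IsPrimitive) {r : ℕ} (hr : Even r) {S : Matrix ι ι F} (hS : S.IsSymm) (hS0 : S ≠ 0)
    (i₀ : ι) {δ : F} (hδ : δ ≠ 0) :
    (∑ A : SymMat ι F, lowRank r A.1 * ψ (S * A.1).trace).re
      ≤ (∑ A : SymMat ι F, lowRank r A.1 * ψ (δ * A.1 i₀ i₀)).re := by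
  obtain ⟨Q, d, hQ, rfl⟩ := exists_eq_transpose_mul_diagonal_mul (Ring.two_ne_zero h2) hS
  have hd : d ≠ 0 := by
    rintro rfl
    simp at hS0
  have hQt : IsUnit Qᵀ.det := by rwa [det_transpose]
  have h1 : ∑ A : SymMat ι F, lowRank r A.1 * ψ (Qᵀ * diagonal d * Q * A.1).trace
      = diagFourier ψ (lowRank r) d := by
    unfold diagFourier
    rw [← sum_symMat_congr Qᵀ hQt fun A => lowRank r A * ψ (∑ i, d i * A i i)]
    refine Finset.sum_congr rfl fun A _ => ?_
    rw [congrInvariant_lowRank r _ _ hQt, transpose_transpose]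
    congr 2
    rw [Matrix.mul_assoc, Matrix.mul_assoc, trace_mul_comm, Matrix.mul_assoc]
    simp [trace, diagonal_mul]
  have h3 : ∑ A : SymMat ι F, lowRank r A.1 * ψ (δ * A.1 i₀ i₀)
      = diagFourier ψ (lowRank r) (Pi.single i₀ δ) := by
    unfold diagFourier
    refine Finset.sum_congr rfl fun A _ => ?_
    simp [Pi.single_apply]
  rw [h1, h3]
  exact re_diagFourier_lowRank_le h2 hψ hr hd i₀ hδ

end Comparison

/-! ### Weights of codewords -/

/-- Comparison of Hamming weights through the character sums of the nonzero multiples of two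
words. -/
theorem hammingNorm_le_of_re_sum_le {F ι : Type*} [Field F] [Fintype F] [DecidableEq F] [Fintype ι]
    {ψ : AddChar F ℂ} (hψ : ψ.IsPrimitive) (x y : ι → F)
    (h : ∀ u : F, u ≠ 0 → (∑ i, ψ (u * y i)).re ≤ (∑ i, ψ (u * x i)).re) :
    hammingNorm x ≤ hammingNorm y := by
  have key : ∀ w : ι → F, ∑ u : F, ∑ i, ψ (u * w i)
      = ((Fintype.card F * (Finset.univ.filter fun i => w i = 0).card : ℕ) : ℂ) := fun w => by
    rw [Finset.sum_comm, Finset.sum_congr rfl fun i _ => AddChar.sum_mulShift (w i) hψ]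
    push_cast
    rw [← Finset.sum_filter, Finset.sum_const, nsmul_eq_mul, mul_comm]
  have hle : (∑ u : F, ∑ i, ψ (u * y i)).re ≤ (∑ u : F, ∑ i, ψ (u * x i)).re := by
    rw [Complex.re_sum, Complex.re_sum]
    refine Finset.sum_le_sum fun u _ => ?_
    by_cases hu : u = 0
    · simp [hu]
    · exact h u hu
  rw [key, key, Complex.natCast_re, Complex.natCast_re, Nat.cast_le] at hle
  have hz := Nat.le_of_mul_le_mul_left hle Fintype.card_pos
  have hc : ∀ w : ι → F, (Finset.univ.filter fun i => w i = 0).card + hammingNorm w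
      = Fintype.card ι := fun w => by
    rw [hammingNorm, Finset.card_filter_add_card_filter_not]
    rfl
  have hx := hc x
  have hy := hc y
  omega

/-- Every word of the code is given by the trace form with a symmetric matrix. -/
theorem exists_symm_of_mem_affineSymmCode {F : Type*} [Field F] (h2 : (2 : F) ≠ 0) {t m : ℕ}
    {c : SymmDet F t m → F} (hc : c ∈ affineSymmCode F t m) :
    ∃ S : Matrix (Fin m) (Fin m) F, S.IsSymm ∧ ∀ A, c A = (S * A.1).trace := by
  obtain ⟨f, hf, rfl⟩ := hc
  have hM : ∃ M : Matrix (Fin m) (Fin m) F,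
      ∀ A : SymmDet F t m, symmEv F t m f A = (M * A.1).trace := by
    rw [SetLike.mem_coe, homogeneousSubmodule_one_eq_span_X] at hf
    induction hf using Submodule.span_induction with
    | mem f hf =>
      obtain ⟨⟨i, j⟩, rfl⟩ := hf
      -- The trace form pairs `X (i, j)` with the transposed matrix unit.
      refine ⟨Matrix.single j i 1, fun A => ?_⟩
      simp [symmEv, Matrix.trace_single_mul]
    | zero => exact ⟨0, fun A => by simp⟩
    | add f g _ _ hf hg =>
      obtain ⟨M, hM⟩ := hf
      obtain ⟨N, hN⟩ := hg
      exact ⟨M + N, fun A => by simp [hM, hN, Matrix.add_mul]⟩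
    | smul a f _ hf =>
      obtain ⟨M, hM⟩ := hf
      exact ⟨a • M, fun A => by simp [hM]⟩
  obtain ⟨M, hM⟩ := hM
  -- On symmetric matrices, `M` may be replaced by its symmetrization.
  refine ⟨(2 : F)⁻¹ • (M + Mᵀ), (isSymm_add_transpose_self M).smul _, fun A => ?_⟩
  have hT : (Mᵀ * A.1).trace = (M * A.1).trace := by
    rw [← Matrix.trace_transpose, Matrix.transpose_mul, transpose_transpose, A.2.1.eq,
      Matrix.trace_mul_comm]
  rw [hM, Matrix.smul_mul, Matrix.add_mul, trace_smul, trace_add, hT, smul_eq_mul]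
  field_simp
  ring

/-- Sums over the points of the determinantal variety as sums over all symmetric matrices. -/
theorem sum_symmDet {F : Type*} [Field F] [Fintype F] (r m : ℕ)
    (f : Matrix (Fin m) (Fin m) F → ℂ) :
    ∑ A : SymmDet F r m, f A.1 = ∑ A : SymMat (Fin m) F, lowRank r A.1 * f A.1 := by
  simp only [lowRank, ite_mul, one_mul, zero_mul]
  rw [← Finset.sum_filter]
  refine Finset.sum_bij (fun A _ => ⟨A.1, A.2.1⟩) (fun A _ => by simpa using A.2.2)
    (fun A _ B _ h => Subtype.ext (congrArg Subtype.val h :))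
    (fun B hB => ⟨⟨B.1, B.2, by simpa using hB⟩, Finset.mem_univ _, rfl⟩) (fun _ _ => rfl)

theorem symmEv_diagForm_one {F : Type*} [Field F] {t m : ℕ} (i₀ : Fin m) (hi₀ : i₀.1 = 0) (δ : F)
    (A : SymmDet F t m) : symmEv F t m (diagForm m 1 δ) A = δ * A.1 i₀ i₀ := by
  have h : ∀ j : Fin m, (j.1 = 0) = (j = i₀) := fun j => by simp [Fin.ext_iff, hi₀]
  simp [symmEv, diagForm, h]

theorem theorem4 {F : Type*} [Field F] [Fintype F] [DecidableEq F]
    (hq : Odd (Fintype.card F)) (t m : ℕ) (ht : 0 < t) (htm : 2 * t ≤ m)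
    (δ : F) (hδ : δ ≠ 0) :
    IsMinDist (affineSymmCode F (2 * t) m) (symmWeight 1 δ (2 * t) m) := by
  have h2 : ringChar F ≠ 2 := fun h => by
    have := FiniteField.even_card_iff_char_two.1 h
    have := Nat.odd_iff.1 hq
    omega
  have h2' : (2 : F) ≠ 0 := Ring.two_ne_zero h2
  obtain ⟨ψ, hψ1⟩ := AddChar.exists_apply_ne_zero.2 (one_ne_zero (α := F))
  have hψ : ψ.IsPrimitive := AddChar.IsPrimitive.of_ne_one fun h => hψ1 (by rw [h]; rfl)
  let i₀ : Fin m := ⟨0, by omega⟩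
  have hev := symmEv_diagForm_one (F := F) (t := 2 * t) i₀ rfl δ
  constructor
  · refine ⟨symmEv F (2 * t) m (diagForm m 1 δ), ?_, 0, Submodule.zero_mem _, ?_, ?_⟩
    · refine Submodule.mem_map_of_mem (Submodule.sum_mem _ fun j _ => ?_)
      rw [C_mul']
      exact Submodule.smul_mem _ _ (isHomogeneous_X F _)
    · intro h
      have hE : (Matrix.single i₀ i₀ (1 : F)).IsSymm := by
        simp [IsSymm]
      have hr : (Matrix.single i₀ i₀ (1 : F)).rank ≤ 2 * t := by
        have h1 := rank_vecMulVec_le (Pi.single i₀ (1 : F)) (Pi.single i₀ (1 : F))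
        rw [← Matrix.single_eq_single_vecMulVec_single] at h1
        omega
      have := congrFun h ⟨_, hE, hr⟩
      rw [hev] at this
      simp [hδ] at this
    · rw [hammingDist_zero_right]; rfl
  · rintro n ⟨x, hx, y, hy, hxy, rfl⟩
    obtain ⟨S, hS, hxS⟩ := exists_symm_of_mem_affineSymmCode h2' (Submodule.sub_mem _ hx hy)
    have hS0 : S ≠ 0 := by
      rintro rfl
      refine hxy (sub_eq_zero.1 (funext fun A => ?_))
      rw [hxS]
      simp
    rw [hammingDist_comm, hammingDist_eq_hammingNorm, neg_add_eq_sub]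
    refine hammingNorm_le_of_re_sum_le hψ _ _ fun u hu => ?_
    simp only [hev]
    have h1 : ∀ A, u * (x - y) A = ((u • S) * A.1).trace := fun A => by
      rw [hxS, Matrix.smul_mul, trace_smul, smul_eq_mul]
    simp only [h1, ← mul_assoc u δ]
    rw [sum_symmDet (2 * t) m fun A : Matrix (Fin m) (Fin m) F => ψ ((u • S) * A).trace,
      sum_symmDet (2 * t) m fun A : Matrix (Fin m) (Fin m) F => ψ (u * δ * A i₀ i₀)]
    exact re_sum_lowRank_le h2 hψ (even_two_mul t) (hS.smul u) (smul_ne_zero hu hS0) i₀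
      (mul_ne_zero hu hδ)
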